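/- A matrix $T\in\mathbb{C}^{n\times n}$ is called Toeplitz if $T_{i,j}=T_{i+1,j+1}$ for all $i,j=1,\dots,n-1$. For $M\in\mathbb{C}^{n\times n}$, the Toeplitz number $\mathrm{Toep}(M)$ is the minimal $s\ge 1$ such that $M=T_1T_2\cdots T_s$ for some Toeplitz matrices $T_1,\dots,T_s\in\mathbb{C}^{n\times n}$ (and $\mathrm{Toep}(M)=\infty$ if no such $s$ exists). Proposition. Let $M\in\mathbb{C}^{4\times 4}$ be a matrix of rank $2$. Then $\mathrm{Toep}(M)\le 9$; that is, $M$ is a product of at most $9$ Toeplitz matrices of size $4\times 4$. -/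

import Mathlib

/-- A square complex matrix is Toeplitz if it is constant along its descending diagonals:
`M i j = M (i + 1) (j + 1)` whenever both positions lie in the matrix. -/
def IsToeplitz {n : ℕ} (M : Matrix (Fin n) (Fin n) ℂ) : Prop :=
  ∀ (i j : ℕ) (hi : i + 1 < n) (hj : j + 1 < n),
    M ⟨i, Nat.lt_of_succ_lt hi⟩ ⟨j, Nat.lt_of_succ_lt hj⟩ = M ⟨i + 1, hi⟩ ⟨j + 1, hj⟩

/-- `L = (T₁, …, T_s)`, with `s ≥ 1`, is a Toeplitz decomposition of `M`: every `T_i` is Toeplitz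
and `M = T₁ * ⋯ * T_s`. Its length is `s = L.length`. -/
def IsToeplitzDecomposition {n : ℕ} (L : List (Matrix (Fin n) (Fin n) ℂ))
    (M : Matrix (Fin n) (Fin n) ℂ) : Prop :=
  L ≠ [] ∧ (∀ T ∈ L, IsToeplitz T) ∧ L.prod = M

/-- The Toeplitz number of `M`: the minimal length of a Toeplitz decomposition of `M`
(with value `⊤` if there were no decomposition). -/
noncomputable def toeplitzNumber {n : ℕ} (M : Matrix (Fin n) (Fin n) ℂ) : ℕ∞ :=
  sInf {s : ℕ∞ | ∃ L : List (Matrix (Fin n) (Fin n) ℂ),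
    IsToeplitzDecomposition L M ∧ s = (L.length : ℕ∞)}

/-! Six factors suffice. Factor M = AB through ℂ² and insert an invertible G, so that M =
(AG)(G⁻¹B). With E the first two columns of the identity, AG = LTE for Toeplitz L, T, and likewise
for the transpose of G⁻¹B (`exists_toeplitz_mul_toeplitz_mul_firstTwoColumns`). The middle EEᵀ is
again a product of two Toeplitz matrices (`firstTwoColumns_mul_transpose`). -/

open PowerSeries in
/-- The lower triangular Toeplitz matrix of multiplication by a power series modulo `X ^ n`. -/
noncomputable def lowerToeplitz (n : ℕ) (p : PowerSeries ℂ) : Matrix (Fin n) (Fin n) ℂ :=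
  Matrix.of fun i j => if (j : ℕ) ≤ i then coeff ((i : ℕ) - j) p else 0

/-- The nilpotent matrix with ones on the first superdiagonal. -/
def upperShift (n : ℕ) : Matrix (Fin n) (Fin n) ℂ :=
  Matrix.of fun i j => if (j : ℕ) = i + 1 then 1 else 0

/-- The first two columns of the identity matrix of size four. -/
def firstTwoColumns : Matrix (Fin 4) (Fin 2) ℂ :=
  Matrix.of fun i j => if (i : ℕ) = j then 1 else 0

theorem isToeplitz_lowerToeplitz (n : ℕ) (p : PowerSeries ℂ) :
    IsToeplitz (lowerToeplitz n p) := by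
  intro i j hi hj
  simp [lowerToeplitz]

theorem isToeplitz_upperShift (n : ℕ) : IsToeplitz (upperShift n) := by
  intro i j hi hj
  simp [upperShift]

theorem IsToeplitz.add {n : ℕ} {S T : Matrix (Fin n) (Fin n) ℂ} (hS : IsToeplitz S)
    (hT : IsToeplitz T) : IsToeplitz (S + T) := by
  intro i j hi hj
  simp only [Matrix.add_apply, hS i j hi hj, hT i j hi hj]

theorem IsToeplitz.transpose {n : ℕ} {T : Matrix (Fin n) (Fin n) ℂ} (hT : IsToeplitz T) :
    IsToeplitz T.transpose :=
  fun i j hi hj => hT j i hj hi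

theorem isToeplitz_upperShift_sq : IsToeplitz (upperShift 4 * upperShift 4) := by
  intro i j hi hj
  have hi' : i < 3 := by omega
  have hj' : j < 3 := by omega
  interval_cases i <;> interval_cases j <;>
    simp [upperShift, Matrix.mul_apply, Fin.sum_univ_four]

/-- Both sides are diag(1, 1, 0, 0). -/
theorem firstTwoColumns_mul_transpose :
    firstTwoColumns * firstTwoColumns.transpose =
      (upperShift 4 * upperShift 4) * (upperShift 4 * upperShift 4).transpose := by
  ext i j
  fin_cases i <;> fin_cases j <;>
    simp [upperShift, firstTwoColumns, Matrix.mul_apply, Fin.sum_univ_four]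

open PowerSeries in
/-- Multiplication by `lowerToeplitz` is multiplication of truncated power series. -/
theorem lowerToeplitz_mulVec_coeff (p q : PowerSeries ℂ) (i : Fin 4) :
    ∑ k : Fin 4, lowerToeplitz 4 p i k * coeff (k : ℕ) q = coeff (i : ℕ) (p * q) := by
  rw [mul_comm p q, coeff_mul, Finset.Nat.sum_antidiagonal_eq_sum_range_succ_mk]
  fin_cases i <;> simp [lowerToeplitz, Fin.sum_univ_four, Finset.sum_range_succ] <;> ring

-- Read columns as truncated power series. The first two columns of `lowerToeplitz 4 u + upperShift
-- 4` are u and 1 + Xu, so it suffices to write the columns of A as X^a·p times these.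
open PowerSeries in
theorem exists_toeplitz_mul_toeplitz_mul_firstTwoColumns (A : Matrix (Fin 4) (Fin 2) ℂ)
    (a : Fin 4) (hA : ∀ i < a, ∀ j, A i j = 0) (ha : A a 1 ≠ 0) :
    ∃ L T : Matrix (Fin 4) (Fin 4) ℂ, IsToeplitz L ∧ IsToeplitz T ∧
      A = L * T * firstTwoColumns := by
  -- Column j with its `a` leading zeros stripped, so that `s 1` is a unit.
  let s : Fin 2 → PowerSeries ℂ := fun j =>
    PowerSeries.mk fun m => if h : m + a < 4 then A ⟨m + a, h⟩ j else 0
  have hs : ∀ i j, A i j = coeff (i : ℕ) (X ^ (a : ℕ) * s j) := by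
    intro i j
    rw [coeff_X_pow_mul']
    split_ifs with h
    · have h' : (i : ℕ) - a + a = i := Nat.sub_add_cancel h
      simp [s, h']
    · exact hA i (by simpa using h) j
  have h0 : constantCoeff (s 1) ≠ 0 := by
    simpa [s, ← coeff_zero_eq_constantCoeff_apply] using ha
  -- Forced by s₀ = pu and s₁ = p(1 + Xu): eliminating u gives p = s₁ - Xs₀.
  set p : PowerSeries ℂ := s 1 - X * s 0 with hp
  have hp0 : constantCoeff p ≠ 0 := by simpa [hp] using h0
  have hpi : p * p⁻¹ = 1 := PowerSeries.mul_inv_cancel p hp0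
  set u : PowerSeries ℂ := s 0 * p⁻¹ with hu
  have h1 : s 0 = p * u := by rw [hu]; linear_combination (-(s 0)) * hpi
  have h2 : s 1 = p * (1 + X * u) := by
    linear_combination X * h1 - hp
  refine ⟨lowerToeplitz 4 (X ^ (a : ℕ) * p), lowerToeplitz 4 u + upperShift 4,
    isToeplitz_lowerToeplitz _ _,
    (isToeplitz_lowerToeplitz _ _).add (isToeplitz_upperShift _), ?_⟩
  have hT : ∀ k : Fin 4, ∀ j : Fin 2,
      ((lowerToeplitz 4 u + upperShift 4) * firstTwoColumns) k j =
        coeff (k : ℕ) (if j = 0 then u else 1 + X * u) := by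
    intro k j
    fin_cases k <;> fin_cases j <;>
      simp [lowerToeplitz, upperShift, firstTwoColumns, Matrix.mul_apply, Fin.sum_univ_four,
        coeff_one]
  ext i j
  rw [Matrix.mul_assoc, Matrix.mul_apply, hs]
  simp_rw [hT]
  rw [lowerToeplitz_mulVec_coeff, mul_assoc]
  fin_cases j
  · simp [← h1]
  · simp [← h2]

/-- A change of basis of the plane giving a nonzero functional and a nonzero vector nonzero last
coordinates. -/
theorem exists_mul_eq_one_and_last_ne_zero (r k : Fin 2 → ℂ) (hr : r ≠ 0) (hk : k ≠ 0) :
    ∃ G H : Matrix (Fin 2) (Fin 2) ℂ, G * H = 1 ∧ (Matrix.vecMul r G) 1 ≠ 0 ∧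
      (H.mulVec k) 1 ≠ 0 := by
  -- Only the second column of G and the second row of H = G⁻¹ matter; each case picks these to meet
  -- a nonzero entry of r and of k.
  by_cases h1 : r 1 = 0 <;> by_cases h2 : k 1 = 0
  · refine ⟨!![0, 1; 1, 0], !![0, 1; 1, 0], ?_, ?_, ?_⟩
    · simp [Matrix.one_fin_two]
    · intro h; apply hr; ext i; fin_cases i <;> simp_all [Matrix.vecMul, dotProduct]
    · intro h; apply hk; ext i; fin_cases i <;> simp_all [Matrix.mulVec, dotProduct]
  · refine ⟨!![1, 1; 0, 1], !![1, -1; 0, 1], ?_, ?_, ?_⟩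
    · simp [Matrix.one_fin_two]
    · intro h; apply hr; ext i; fin_cases i <;> simp_all [Matrix.vecMul, dotProduct]
    · simpa [Matrix.mulVec, dotProduct] using h2
  · refine ⟨!![1, 0; -1, 1], !![1, 0; 1, 1], ?_, ?_, ?_⟩
    · simp [Matrix.one_fin_two]
    · simpa [Matrix.vecMul, dotProduct] using h1
    · intro h; apply hk; ext i; fin_cases i <;> simp_all [Matrix.mulVec, dotProduct]
  · exact ⟨1, 1, by simp, by simpa using h1, by simpa using h2⟩

theorem exists_first_nonzero_row {n m : ℕ} (A : Matrix (Fin n) (Fin m) ℂ) (hA : A ≠ 0) :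
    ∃ a, A a ≠ 0 ∧ ∀ i < a, A i = 0 := by
  have hne : {i | A i ≠ 0}.Nonempty := by
    by_contra h
    rw [Set.not_nonempty_iff_eq_empty] at h
    apply hA
    funext i
    by_contra hi
    exact (h ▸ (show i ∈ {i | A i ≠ 0} from hi) : i ∈ (∅ : Set (Fin n)))
  obtain ⟨a, ha, hmin⟩ := WellFounded.has_min (wellFounded_lt (α := Fin n)) _ hne
  exact ⟨a, ha, fun i hi => by_contra fun h => hmin i h hi⟩

/-- Rank factorization. -/
theorem exists_eq_mul_of_rank_eq {n m r : ℕ} (M : Matrix (Fin n) (Fin m) ℂ) (hM : M.rank = r) :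
    ∃ (A : Matrix (Fin n) (Fin r) ℂ) (B : Matrix (Fin r) (Fin m) ℂ), M = A * B := by
  let b := Module.finBasisOfFinrankEq ℂ (LinearMap.range M.mulVecLin) hM
  refine ⟨Matrix.of fun i j => (b j : Fin n → ℂ) i,
    Matrix.of fun j k => b.repr ⟨M.mulVecLin (Pi.single k 1), LinearMap.mem_range_self _ _⟩ j, ?_⟩
  ext i k
  have h := congrArg (fun x : LinearMap.range M.mulVecLin => (x : Fin n → ℂ) i)
    (b.sum_repr ⟨M.mulVecLin (Pi.single k 1), LinearMap.mem_range_self _ _⟩)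
  simp only [AddSubmonoidClass.coe_finsetSum, Finset.sum_apply, Submodule.coe_smul,
    Pi.smul_apply, smul_eq_mul, Matrix.mulVecLin_apply, Matrix.mulVec_single_one,
    Matrix.col_apply] at h
  rw [Matrix.mul_apply, ← h]
  exact Finset.sum_congr rfl fun j _ => by simp [mul_comm]

theorem mainTheorem7 (M : Matrix (Fin 4) (Fin 4) ℂ) (hM : M.rank = 2) :
    toeplitzNumber M ≤ 9 := by
  obtain ⟨A, B, rfl⟩ := exists_eq_mul_of_rank_eq M hM
  have hA : A ≠ 0 := by rintro rfl; simp at hM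
  have hB : B.transpose ≠ 0 := by
    intro h
    rw [Matrix.transpose_eq_zero] at h
    simp [h] at hM
  obtain ⟨a, ha, ha'⟩ := exists_first_nonzero_row A hA
  obtain ⟨b, hb, hb'⟩ := exists_first_nonzero_row B.transpose hB
  obtain ⟨G, H, hGH, hG, hH⟩ := exists_mul_eq_one_and_last_ne_zero _ _ ha hb
  obtain ⟨L, T, hL, hT, hLT⟩ := exists_toeplitz_mul_toeplitz_mul_firstTwoColumns (A * G) a
    (fun i hi j => by rw [Matrix.mul_apply_eq_vecMul, ha' i hi]; simp) hG
  obtain ⟨L', T', hL', hT', hLT'⟩ := exists_toeplitz_mul_toeplitz_mul_firstTwoColumns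
    (H * B).transpose b
    (fun i hi j => by
      rw [Matrix.transpose_mul, Matrix.mul_apply_eq_vecMul, hb' i hi]; simp)
    (by rw [Matrix.transpose_mul, Matrix.mul_apply_eq_vecMul, Matrix.vecMul_transpose]; exact hH)
  have hHB : H * B = firstTwoColumns.transpose * (T'.transpose * L'.transpose) := by
    rw [← Matrix.transpose_mul, ← Matrix.transpose_mul, ← hLT', Matrix.transpose_transpose]
  have hprod : A * B = (A * G) * (H * B) := by
    rw [Matrix.mul_assoc, ← Matrix.mul_assoc G, hGH, Matrix.one_mul]
  have hU := isToeplitz_upperShift_sq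
  set U := upperShift 4 * upperShift 4 with hUdef
  have key : IsToeplitzDecomposition
      [L, T, U, U.transpose, T'.transpose, L'.transpose] (A * B) := by
    refine ⟨by simp, ?_, ?_⟩
    · simp only [List.mem_cons, List.not_mem_nil, or_false]
      rintro S (rfl | rfl | rfl | rfl | rfl | rfl)
      exacts [hL, hT, hU, hU.transpose, hT'.transpose, hL'.transpose]
    · rw [hprod, hLT, hHB, Matrix.mul_assoc (L * T), ← Matrix.mul_assoc firstTwoColumns,
        firstTwoColumns_mul_transpose, ← hUdef]
      simp [Matrix.mul_assoc]
  calc toeplitzNumber (A * B) ≤ (6 : ℕ) := sInf_le ⟨_, key, rfl⟩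
    _ ≤ 9 := by norm_num
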